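/- **Theorem 2.5 (generalized Lax–Friedrichs splitting for the special relativistic MHD equations).** Let $\Gamma\in(1,2]$. A primitive state $V=(\rho,\mathbf v,\mathbf B,p)\in\mathbb R\times\mathbb R^3\times\mathbb R^3\times\mathbb R$ (with $\rho\ne0$ and $|\mathbf v|<1=c$) determines the Lorentz factor $W=1/\sqrt{1-|\mathbf v|^2}$, the specific internal energy $e=p/((\Gamma-1)\rho)$, the specific enthalpy $h=1+e+p/\rho$, the magnetic pressure $p_m=\frac12\big(W^{-2}|\mathbf B|^2+(\mathbf v\cdot\mathbf B)^2\big)$, the total pressure $p_{tot}=p+p_m$, and the conservative vector $\mathbf U(V)=(D,\mathbf m,\mathbf B,E)\in\mathbb R^8$ with $$D=\rho W,\qquad \mathbf m=\rho hW^2\mathbf v+|\mathbf B|^2\mathbf v-(\mathbf v\cdot\mathbf B)\mathbf B,\qquad E=\rho hW^2-p_{tot}+|\mathbf B|^2 .$$ The admissible state set $\mathcal G\subset\mathbb R^8$ consists of the conservative vectors $\mathbf U$ that come from primitive states with $\rho>0$, $p>0$ and $|\mathbf v|<1$; these primitive variables are uniquely determined by $\mathbf U\in\mathcal G$. For $\mathbf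 U\in\mathcal G$ and $k\in\{1,2,3\}$ the flux is $$\mathbf F_k(\mathbf U)=\Big(Dv_k,\; v_k\mathbf m-B_k\big(W^{-2}\mathbf B+(\mathbf v\cdot\mathbf B)\mathbf v\big)+p_{tot}\mathbf e_k,\; v_k\mathbf B-B_k\mathbf v,\; m_k\Big),$$ where $\mathbf e_k$ is the $k$-th standard basis vector of $\mathbb R^3$. Let $\omega_1,\dots,\omega_L>0$ with $\sum_{i=1}^L\omega_i=1$, and let $\alpha\ge 1$. For $\mathbf U,\mathbf U'\in\mathcal G$ put $$\mathcal L_k(\mathbf U,\mathbf U')=\mathbf U-\alpha^{-1}\mathbf F_k(\mathbf U)+\mathbf U'+\alpha^{-1}\mathbf F_k(\mathbf U').$$ (a) *Two dimensions.* Let $\Delta x,\Delta y>0$ and let $\tilde{\mathbf U}^i,\hat{\mathbf U}^i,\bar{\mathbf U}^i,\breve{\mathbf U}^i\in\mathcal G$ $(1\le i\le L)$ satisfy the discrete divergence-free condition $$\frac{1}{\Delta x}\sum_{i=1}^L\omega_i(\tilde B_1^i-\hat B_1^i)+\frac1{\Delta y}\sum_{i=1}^L\omega_i(\bar B_2^i-\breve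 B_2^i)=0 .$$ Then $$\frac{1}{2\left(\frac1{\Delta x}+\frac1{\Delta y}\right)}\sum_{i=1}^L\omega_i\Big[\frac1{\Delta x}\mathcal L_1(\tilde{\mathbf U}^i,\hat{\mathbf U}^i)+\frac1{\Delta y}\mathcal L_2(\bar{\mathbf U}^i,\breve{\mathbf U}^i)\Big]\in\mathcal G .$$ (b) *Three dimensions.* Let $\Delta x,\Delta y,\Delta z>0$ and let $\tilde{\mathbf U}^i,\hat{\mathbf U}^i,\bar{\mathbf U}^i,\breve{\mathbf U}^i,\bar{\bar{\mathbf U}}^i,\breve{\breve{\mathbf U}}^i\in\mathcal G$ $(1\le i\le L)$ satisfy $$\frac{1}{\Delta x}\sum_{i=1}^L\omega_i(\tilde B_1^i-\hat B_1^i)+\frac1{\Delta y}\sum_{i=1}^L\omega_i(\bar B_2^i-\breve B_2^i)+\frac1{\Delta z}\sum_{i=1}^L\omega_i(\bar{\bar B}_3^i-\breve{\breve B}_3^i)=0 .$$ Then $$\frac{1}{2\left(\frac1{\Delta x}+\frac1{\Delta y}+\frac1{\Delta z}\right)}\sum_{i=1}^L\omega_i\Big[\frac1{\Delta x}\mathcal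 L_1(\tilde{\mathbf U}^i,\hat{\mathbf U}^i)+\frac1{\Delta y}\mathcal L_2(\bar{\mathbf U}^i,\breve{\mathbf U}^i)+\frac1{\Delta z}\mathcal L_3(\bar{\bar{\mathbf U}}^i,\breve{\breve{\mathbf U}}^i)\Big]\in\mathcal G .$$ (c) *Convex polygonal cells.* Let a $J$-sided convex polygon in $\mathbb R^2$ have edge lengths $\ell_j>0$ and unit outward normals $(\mathcal N_1^j,\mathcal N_2^j)$, $1\le j\le J$, and let $\mathbf U^{ij}\in\mathcal G$ $(1\le i\le L,\ 1\le j\le J)$ satisfy $$\sum_{j=1}^J\Big[\sum_{i=1}^L\omega_i\big(B_1^{ij}\mathcal N_1^j+B_2^{ij}\mathcal N_2^j\big)\Big]\ell_j=0 .$$ Then $$\frac1{\sum_{j=1}^J\ell_j}\sum_{j=1}^J\Big[\sum_{i=1}^L\omega_i\Big(\mathbf U^{ij}-\alpha^{-1}\big(\mathbf F_1(\mathbf U^{ij})\mathcal N_1^j+\mathbf F_2(\mathbf U^{ij})\mathcal N_2^j\big)\Big)\Big]\ell_j\in\mathcal G .$$ -/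

import Mathlib

open scoped BigOperators Matrix

namespace RMHD

/-- Conservative states `U = (D, m, B, E) ∈ ℝ⁸`, with componentwise vector space structure. -/
abbrev ConsState : Type := ℝ × (Fin 3 → ℝ) × (Fin 3 → ℝ) × ℝ

/-- The magnetic field `B` of `U = (D, m, B, E)`. -/
def magneticField (U : ConsState) : Fin 3 → ℝ := U.2.2.1

/-- Primitive states `V = (ρ, v, B, p)`: rest-mass density, velocity, magnetic field, gas
pressure. -/
@[ext] structure PrimState where
  rho : ℝ
  v : Fin 3 → ℝ
  B : Fin 3 → ℝ
  p : ℝ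

namespace PrimState

/-- The speed `|v|` (Euclidean length of the velocity). -/
noncomputable def speed (V : PrimState) : ℝ := Real.sqrt (V.v ⬝ᵥ V.v)

/-- The physical constraints `ρ > 0`, `p > 0`, `|v| < c = 1`. -/
def Admissible (V : PrimState) : Prop := 0 < V.rho ∧ 0 < V.p ∧ V.speed < 1

/-- The Lorentz factor `W = 1 / √(1 - v²)`. -/
noncomputable def lorentz (V : PrimState) : ℝ := 1 / Real.sqrt (1 - V.speed ^ 2)

/-- The specific internal energy `e`, from the `Γ`-law `p = (Γ - 1) ρ e`. -/
noncomputable def internalEnergy (Γ : ℝ) (V : PrimState) : ℝ := V.p / ((Γ - 1) * V.rho)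

/-- The specific enthalpy `h = 1 + e + p / ρ`. -/
noncomputable def enthalpy (Γ : ℝ) (V : PrimState) : ℝ :=
  1 + V.internalEnergy Γ + V.p / V.rho

/-- The magnetic pressure `p_m = (W⁻² |B|² + (v·B)²) / 2`. -/
noncomputable def magneticPressure (V : PrimState) : ℝ :=
  (V.lorentz⁻¹ ^ 2 * (V.B ⬝ᵥ V.B) + (V.v ⬝ᵥ V.B) ^ 2) / 2

/-- The total pressure `p_tot = p + p_m`. -/
noncomputable def totalPressure (V : PrimState) : ℝ := V.p + V.magneticPressure

/-- The mass density `D = ρ W`. -/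
noncomputable def massDensity (V : PrimState) : ℝ := V.rho * V.lorentz

/-- The momentum density `m = ρ h W² v + |B|² v - (v·B) B`. -/
noncomputable def momentum (Γ : ℝ) (V : PrimState) : Fin 3 → ℝ :=
  (V.rho * V.enthalpy Γ * V.lorentz ^ 2) • V.v + (V.B ⬝ᵥ V.B) • V.v - (V.v ⬝ᵥ V.B) • V.B

/-- The energy density `E = ρ h W² - p_tot + |B|²`. -/
noncomputable def energy (Γ : ℝ) (V : PrimState) : ℝ :=
  V.rho * V.enthalpy Γ * V.lorentz ^ 2 - V.totalPressure + V.B ⬝ᵥ V.B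

/-- The conservative vector `U(V) = (D, m, B, E)`. -/
noncomputable def toCons (Γ : ℝ) (V : PrimState) : ConsState :=
  (V.massDensity, V.momentum Γ, V.B, V.energy Γ)

/-- The flux in direction `x_i` in terms of the primitive variables:
`(D v_i, v_i m - B_i (W⁻² B + (v·B) v) + p_tot e_i, v_i B - B_i v, m_i)`. -/
noncomputable def flux (Γ : ℝ) (i : Fin 3) (V : PrimState) : ConsState :=
  (V.massDensity * V.v i,
   V.v i • V.momentum Γ - V.B i • (V.lorentz⁻¹ ^ 2 • V.B + (V.v ⬝ᵥ V.B) • V.v)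
     + V.totalPressure • Pi.single i 1,
   V.v i • V.B - V.B i • V.v,
   V.momentum Γ i)

end PrimState

/-- The admissible state set `𝒢`: the conservative vectors whose primitive variables satisfy
`ρ(U) > 0`, `p(U) > 0`, `v(U) < 1`. -/
def admissibleSet (Γ : ℝ) : Set ConsState :=
  {U | ∃ V : PrimState, V.Admissible ∧ V.toCons Γ = U}

open Classical in
/-- The primitive variables `V(U)` of an admissible conservative vector `U`. They are uniquely
determined, see `prim_toCons`. Outside `𝒢` the value is irrelevant. -/
noncomputable def prim (Γ : ℝ) (U : ConsState) : PrimState :=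
  if h : ∃ V : PrimState, V.Admissible ∧ V.toCons Γ = U then h.choose else ⟨0, 0, 0, 0⟩

/-- The flux `F_i(U)` as a function of the conservative vector. -/
noncomputable def flux (Γ : ℝ) (i : Fin 3) (U : ConsState) : ConsState := (prim Γ U).flux Γ i

theorem dot_self_nonneg (a : Fin 3 → ℝ) : 0 ≤ a ⬝ᵥ a := by
  simp only [dotProduct]
  exact Finset.sum_nonneg fun i _ => mul_self_nonneg _

/-- Scalar core of the uniqueness of the primitive variables. -/
theorem xi_mono {k b N q D x y : ℝ} (hk0 : 0 ≤ k) (hk : k ≤ 1 / 2) (hb : 0 ≤ b)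
    (hN : 0 ≤ N) (hq : 0 ≤ q) (hD : 0 ≤ D) (hx : 0 < x) (hxy : x < y)
    (hw : 0 < 1 - N / (x + b) ^ 2 - q / x ^ 2) :
    x - k * (x * (1 - N / (x + b) ^ 2 - q / x ^ 2)
          - D * Real.sqrt (1 - N / (x + b) ^ 2 - q / x ^ 2))
        + b * N / (2 * (x + b) ^ 2)
      < y - k * (y * (1 - N / (y + b) ^ 2 - q / y ^ 2)
          - D * Real.sqrt (1 - N / (y + b) ^ 2 - q / y ^ 2))
        + b * N / (2 * (y + b) ^ 2) := by
  have hy : 0 < y := hx.trans hxy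
  have hxb : 0 < x + b := by linarith
  have hyb : 0 < y + b := by linarith
  have h1 : N / (y + b) ^ 2 ≤ N / (x + b) ^ 2 := by gcongr
  have h2 : q / y ^ 2 ≤ q / x ^ 2 := by gcongr
  have hs : Real.sqrt (1 - N / (x + b) ^ 2 - q / x ^ 2)
      ≤ Real.sqrt (1 - N / (y + b) ^ 2 - q / y ^ 2) := Real.sqrt_le_sqrt (by linarith)
  have hs' := mul_le_mul_of_nonneg_left (mul_le_mul_of_nonneg_left hs hD) hk0
  have key : (y - k * (y * (1 - N / (y + b) ^ 2 - q / y ^ 2)) + b * N / (2 * (y + b) ^ 2))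
      - (x - k * (x * (1 - N / (x + b) ^ 2 - q / x ^ 2)) + b * N / (2 * (x + b) ^ 2))
      = (y - x) * ((1 - k) - k * (N / ((x + b) * (y + b))) - k * (q / (x * y))
        - (1 / 2 - k) * (b * (N / ((x + b) * (y + b))) * (1 / (x + b) + 1 / (y + b)))) := by
    field_simp
    ring
  have a1 : N / ((x + b) * (y + b)) ≤ N / (x + b) ^ 2 := by
    rw [pow_two]; gcongr
  have a2 : q / (x * y) ≤ q / x ^ 2 := by
    rw [pow_two]; gcongr
  have c1 : b * (1 / (x + b) + 1 / (y + b)) ≤ 2 := by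
    have e1 : b * (1 / (x + b)) ≤ 1 := by
      rw [mul_one_div, div_le_one hxb]; linarith
    have e2 : b * (1 / (y + b)) ≤ 1 := by
      rw [mul_one_div, div_le_one hyb]; linarith
    linarith
  have a3 : b * (N / ((x + b) * (y + b))) * (1 / (x + b) + 1 / (y + b))
      ≤ 2 * (N / (x + b) ^ 2) := by
    have n0 : 0 ≤ N / ((x + b) * (y + b)) := by positivity
    calc _ = (N / ((x + b) * (y + b))) * (b * (1 / (x + b) + 1 / (y + b))) := by ring
      _ ≤ (N / ((x + b) * (y + b))) * 2 := mul_le_mul_of_nonneg_left c1 n0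
      _ ≤ _ := by linarith
  have n1 : 0 ≤ q / x ^ 2 := by positivity
  have br : 0 < (1 - k) - k * (N / ((x + b) * (y + b))) - k * (q / (x * y))
        - (1 / 2 - k) * (b * (N / ((x + b) * (y + b))) * (1 / (x + b) + 1 / (y + b))) := by
    have m1 := mul_le_mul_of_nonneg_left a1 hk0
    have m2 := mul_le_mul_of_nonneg_left a2 hk0
    have m3 := mul_le_mul_of_nonneg_left a3 (by linarith : 0 ≤ 1 / 2 - k)
    have m4 : 0 < (1 - k) * (1 - N / (x + b) ^ 2 - q / x ^ 2) := mul_pos (by linarith) hw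
    have m5 : 0 ≤ (1 - 2 * k) * (q / x ^ 2) := mul_nonneg (by linarith) n1
    nlinarith
  have := mul_pos (sub_pos.2 hxy) br
  linarith

/-- An admissible primitive state in terms of its conservative vector `(D, m, B, E)` and the
quantity `ξ = ρ h W²`, with `b = |B|²` and `w = W⁻²`. -/
theorem PrimState.Admissible.relations {Γ : ℝ} (hΓ : 1 < Γ) {V : PrimState}
    (hV : V.Admissible) : ∃ ξ w : ℝ, 0 < ξ ∧ 0 < w ∧
      0 < V.massDensity ∧
      V.rho = V.massDensity * Real.sqrt w ∧
      V.p = (Γ - 1) / Γ * (ξ * w - V.massDensity * Real.sqrt w) ∧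
      V.momentum Γ ⬝ᵥ V.B = ξ * (V.v ⬝ᵥ V.B) ∧
      V.momentum Γ = (ξ + V.B ⬝ᵥ V.B) • V.v - (V.v ⬝ᵥ V.B) • V.B ∧
      w = 1 - V.v ⬝ᵥ V.v ∧
      V.energy Γ = ξ - V.p - (w * (V.B ⬝ᵥ V.B) + (V.v ⬝ᵥ V.B) ^ 2) / 2 + V.B ⬝ᵥ V.B := by
  obtain ⟨hr, hp, hv⟩ := hV
  have vv : 0 ≤ V.v ⬝ᵥ V.v := dot_self_nonneg _
  have hs : V.speed ^ 2 = V.v ⬝ᵥ V.v := Real.sq_sqrt vv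
  have hs0 : 0 ≤ V.speed := Real.sqrt_nonneg _
  have hw : 0 < 1 - V.v ⬝ᵥ V.v := by rw [← hs]; nlinarith
  have hsw := Real.sqrt_pos.2 hw
  have hL : V.lorentz = 1 / Real.sqrt (1 - V.v ⬝ᵥ V.v) := by
    unfold PrimState.lorentz; rw [hs]
  have hLi : V.lorentz⁻¹ ^ 2 = 1 - V.v ⬝ᵥ V.v := by
    rw [hL, one_div, inv_inv, Real.sq_sqrt hw.le]
  have hL2 : V.lorentz ^ 2 = (1 - V.v ⬝ᵥ V.v)⁻¹ := by rw [← hLi, inv_pow, inv_inv]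
  have hLp : 0 < V.lorentz := by rw [hL]; positivity
  have hh : V.rho * V.enthalpy Γ = V.rho + Γ / (Γ - 1) * V.p := by
    have : Γ - 1 ≠ 0 := by linarith
    unfold PrimState.enthalpy PrimState.internalEnergy
    field_simp
    ring
  have hg : 0 < Γ - 1 := by linarith
  have hrh : 0 < V.rho * V.enthalpy Γ := by rw [hh]; positivity
  have hDw : V.massDensity * Real.sqrt (1 - V.v ⬝ᵥ V.v) = V.rho := by
    unfold PrimState.massDensity; rw [hL]; field_simp
  refine ⟨V.rho * V.enthalpy Γ * V.lorentz ^ 2, 1 - V.v ⬝ᵥ V.v, by positivity, hw,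
    mul_pos hr hLp, hDw.symm, ?_, ?_, ?_, rfl, ?_⟩
  · rw [hDw, hL2, mul_assoc, inv_mul_cancel₀ hw.ne', mul_one, hh]
    field_simp
    ring
  · simp only [PrimState.momentum, sub_dotProduct, add_dotProduct, smul_dotProduct, smul_eq_mul]
    ring
  · simp only [PrimState.momentum, add_smul]
  · simp only [PrimState.energy, PrimState.totalPressure, PrimState.magneticPressure, hLi]
    ring

/-- The primitive variables of an admissible state are determined by its conservative vector. -/
theorem toCons_injOn {Γ : ℝ} (hΓ : 1 < Γ) (hΓ2 : Γ ≤ 2) {V V' : PrimState}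
    (hV : V.Admissible) (hV' : V'.Admissible) (h : V.toCons Γ = V'.toCons Γ) : V = V' := by
  obtain ⟨x, w, hx, hw, hD, hr, hp, hmB, hm, hwv, hE⟩ := hV.relations hΓ
  obtain ⟨x', w', hx', hw', hD', hr', hp', hmB', hm', hwv', hE'⟩ := hV'.relations hΓ
  simp only [PrimState.toCons, Prod.mk.injEq] at h
  obtain ⟨e1, e2, e3, e4⟩ := h
  rw [← e1] at hr' hp'
  rw [← e2, ← e3] at hmB' hm'
  rw [← e3, ← e4] at hE'
  set D := V.massDensity with hDdef
  set m := V.momentum Γ with hmdef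
  set B := V.B with hBdef
  set b := B ⬝ᵥ B with hbdef
  set τ := m ⬝ᵥ B with hτ
  have hb : 0 ≤ b := dot_self_nonneg _
  have hmm : 0 ≤ m ⬝ᵥ m := dot_self_nonneg _
  set k := (Γ - 1) / Γ with hk
  have hk0 : 0 ≤ k := div_nonneg (by linarith) (by linarith)
  have hk1 : k ≤ 1 / 2 := by
    rw [hk, div_le_iff₀ (by linarith)]; linarith
  obtain ⟨N, q, hN, hq, hNq, hbq⟩ : ∃ N q : ℝ, 0 ≤ N ∧ 0 ≤ q ∧ m ⬝ᵥ m = N + q ∧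
      τ ^ 2 = b * q := by
    rcases hb.eq_or_lt with h0 | h0
    · have hB0 : B = 0 := dotProduct_self_eq_zero.1 h0.symm
      exact ⟨m ⬝ᵥ m, 0, hmm, le_rfl, by simp, by rw [hτ, hB0]; simp⟩
    · refine ⟨m ⬝ᵥ m - τ ^ 2 / b, τ ^ 2 / b, ?_, by positivity, by ring, by field_simp⟩
      rw [sub_nonneg, div_le_iff₀ h0]
      simp only [τ, b, dotProduct, Fin.sum_univ_three]
      nlinarith [sq_nonneg (m 0 * B 1 - m 1 * B 0), sq_nonneg (m 0 * B 2 - m 2 * B 0),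
        sq_nonneg (m 1 * B 2 - m 2 * B 1)]
  have aux : ∀ (x w : ℝ) (v : Fin 3 → ℝ), 0 < x → τ = x * (v ⬝ᵥ B) →
      m = (x + b) • v - (v ⬝ᵥ B) • B → w = 1 - v ⬝ᵥ v →
      w = 1 - N / (x + b) ^ 2 - q / x ^ 2 ∧
      w * b + (v ⬝ᵥ B) ^ 2 = b - b * N / (x + b) ^ 2 := by
    intro x w v hx h1 h2 h3
    have hxb : 0 < x + b := by linarith
    have hvB : v ⬝ᵥ B = τ / x := by rw [h1]; field_simp
    have hM : m ⬝ᵥ m = (x + b) ^ 2 * (v ⬝ᵥ v) - (2 * x + b) * (v ⬝ᵥ B) ^ 2 := by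
      rw [h2]
      simp only [sub_dotProduct, dotProduct_sub, smul_dotProduct, dotProduct_smul, smul_eq_mul,
        dotProduct_comm B v, ← hbdef]
      ring
    have hw1 : w = 1 - N / (x + b) ^ 2 - q / x ^ 2 := by
      have hvv : v ⬝ᵥ v = (N + q + (2 * x + b) * (τ ^ 2 / x ^ 2)) / (x + b) ^ 2 := by
        rw [eq_div_iff (by positivity), ← hNq, hM, hvB]; ring
      rw [h3, hvv, hbq]
      field_simp
      ring
    refine ⟨hw1, ?_⟩
    rw [hw1, hvB, div_pow, hbq]
    field_simp
    ring
  obtain ⟨f1, f2⟩ := aux x w V.v hx hmB hm hwv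
  obtain ⟨f1', f2'⟩ := aux x' w' V'.v hx' hmB' hm' hwv'
  have F : V.energy Γ - b / 2 = x - k * (x * (1 - N / (x + b) ^ 2 - q / x ^ 2)
          - D * Real.sqrt (1 - N / (x + b) ^ 2 - q / x ^ 2))
        + b * N / (2 * (x + b) ^ 2) := by
    rw [hE, hp, f2, ← f1]
    field_simp
    ring
  have F' : V.energy Γ - b / 2 = x' - k * (x' * (1 - N / (x' + b) ^ 2 - q / x' ^ 2)
          - D * Real.sqrt (1 - N / (x' + b) ^ 2 - q / x' ^ 2))
        + b * N / (2 * (x' + b) ^ 2) := by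
    rw [hE', hp', f2', ← f1']
    field_simp
    ring
  have hxx : x = x' := by
    rcases lt_trichotomy x x' with hlt | heq | hlt
    · have := xi_mono hk0 hk1 hb hN hq hD.le hx hlt (f1 ▸ hw)
      linarith
    · exact heq
    · have := xi_mono hk0 hk1 hb hN hq hD.le hx' hlt (f1' ▸ hw')
      linarith
  subst hxx
  have hww : w = w' := by rw [f1, f1']
  subst hww
  have hvB : V.v ⬝ᵥ B = V'.v ⬝ᵥ B := mul_left_cancel₀ hx.ne' (hmB.symm.trans hmB')
  have hv : V.v = V'.v := by
    have hxb : x + b ≠ 0 := by linarith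
    have := hm.symm.trans hm'
    rw [hvB] at this
    exact smul_right_injective _ hxb (sub_left_injective this)
  exact PrimState.ext (hr.trans hr'.symm) hv e3 (hp.trans hp'.symm)

/-- `V(U(V)) = V` for every admissible primitive state `V`. -/
theorem prim_toCons {Γ : ℝ} (hΓ : 1 < Γ) (hΓ2 : Γ ≤ 2) {V : PrimState} (hV : V.Admissible) :
    prim Γ (V.toCons Γ) = V := by
  have h : ∃ V' : PrimState, V'.Admissible ∧ V'.toCons Γ = V.toCons Γ := ⟨V, hV, rfl⟩
  rw [prim, dif_pos h]
  exact toCons_injOn hΓ hΓ2 h.choose_spec.1 hV h.choose_spec.2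

/-- The Euclidean plane. -/
abbrev Plane : Type := EuclideanSpace ℝ (Fin 2)

/-- The `j`-th edge vector of a polygon, from the `j`-th vertex to the cyclically next one. -/
def edge {J : ℕ} (P : Polygon Plane J) (j : Fin J) : Plane := P (finRotate J j) - P j

/-- `P` is a `J`-sided convex polygon with its vertices listed counterclockwise: for each edge,
all the other vertices lie strictly to the left of the line through the edge. -/
def IsConvexPolygon {J : ℕ} (P : Polygon Plane J) : Prop :=
  3 ≤ J ∧ ∀ j k : Fin J, k ≠ j → k ≠ finRotate J j →
    0 < edge P j 0 * (P k - P j) 1 - edge P j 1 * (P k - P j) 0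

/-- The length `ℓ_j` of the `j`-th edge. -/
noncomputable def edgeLength {J : ℕ} (P : Polygon Plane J) (j : Fin J) : ℝ := ‖edge P j‖

/-- The unit outward normal of the `j`-th edge of a polygon with counterclockwise vertices:
the unit edge direction, turned clockwise by a right angle. -/
noncomputable def outwardNormal {J : ℕ} (P : Polygon Plane J) (j : Fin J) : Plane :=
  (edgeLength P j)⁻¹ • !₂[edge P j 1, -edge P j 0]

end RMHD

namespace RMHD

/-! The nonlinear constraints that define `𝒢` are replaced by affine ones. A state with `D > 0` lies
in `𝒢` as soon as `U · n* + p_m* > 0` for every test velocity `u`, `|u| < 1`, and every test field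
`b` (`mem_admissibleSet_of_dualPairing_pos`). These conditions are affine in `U`, so they can be
checked on averages term by term.

A single term `U - α⁻¹ n · F(U)` need not satisfy them, but its defect is explicit. For `U ∈ 𝒢` and
`|n| ≤ 1`, `dualPairing_flux_pos` gives `(U + n · F(U)) · n* + p_m* (1 + n · u) - (n · B)(u · b) >
0`. Averaged over the faces of a cell, the term in `n · u` vanishes because the weighted normals sum
to zero, and the term in `n · B` vanishes by the discrete divergence-free condition. What remains is
the affine condition for the average. Boxes and polygons are both instances of
`laxFriedrichs_mem_admissibleSet`.

The flux inequality is a dominant energy condition. Its magnetic part is exactly the energy-momentum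
tensor of the difference of two electromagnetic fields, `(-v × B, B)` and `(-u × b, b)`, contracted
with two causal vectors. Its fluid part is positive because `Γ ≤ 2` gives `ρ h ≥ ρ + 2 p`. -/

/-- The linear form `U ↦ U · n*` with
`n* = (-√(1 - |v|²), -v, -(1 - |v|²) B - (v·B) v, 1)`. -/
noncomputable def dualPairing (v B : Fin 3 → ℝ) : ConsState →ₗ[ℝ] ℝ where
  toFun U := U.2.2.2 - Real.sqrt (1 - v ⬝ᵥ v) * U.1 - v ⬝ᵥ U.2.1
    - ((1 - v ⬝ᵥ v) • B + (v ⬝ᵥ B) • v) ⬝ᵥ U.2.2.1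
  map_add' U U' := by
    simp only [Prod.fst_add, Prod.snd_add, dotProduct_add]
    ring
  map_smul' c U := by
    simp only [Prod.smul_fst, Prod.smul_snd, dotProduct_smul, smul_eq_mul, RingHom.id_apply]
    ring

/-- The magnetic pressure `((1 - |v|²) |B|² + (v·B)²) / 2` of the fields `v`, `B`. -/
noncomputable def dualPressure (v B : Fin 3 → ℝ) : ℝ :=
  ((1 - v ⬝ᵥ v) * (B ⬝ᵥ B) + (v ⬝ᵥ B) ^ 2) / 2

/-! ### Causal vectors and dominant energy conditions -/

theorem dot_sq_le (u x : Fin 3 → ℝ) : (u ⬝ᵥ x) ^ 2 ≤ (u ⬝ᵥ u) * (x ⬝ᵥ x) := by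
  simp only [dotProduct, Fin.sum_univ_three]
  nlinarith [sq_nonneg (u 0 * x 1 - u 1 * x 0), sq_nonneg (u 0 * x 2 - u 2 * x 0),
    sq_nonneg (u 1 * x 2 - u 2 * x 1)]

/-- A vector `u` with `|u| < 1` pairs nonnegatively with a causal vector `(a, x)`. -/
theorem dot_le_of_causal {a : ℝ} {u x : Fin 3 → ℝ} (hu : u ⬝ᵥ u < 1) (ha : 0 ≤ a)
    (hx : x ⬝ᵥ x ≤ a ^ 2) : u ⬝ᵥ x ≤ a := by
  have cs := dot_sq_le u x
  have h0 := dot_self_nonneg u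
  have h1 := dot_self_nonneg x
  refine le_of_sq_le_sq ?_ ha
  nlinarith

/-- A vector `u` with `|u| < 1` pairs positively with a nonzero causal vector `(a, x)`. -/
theorem dot_lt_of_causal {a : ℝ} {u x : Fin 3 → ℝ} (hu : u ⬝ᵥ u < 1) (ha : 0 < a)
    (hx : x ⬝ᵥ x ≤ a ^ 2) : u ⬝ᵥ x < a := by
  have cs := dot_sq_le u x
  have h0 := dot_self_nonneg u
  have h1 := dot_self_nonneg x
  refine lt_of_pow_lt_pow_left₀ 2 ha.le ?_
  nlinarith [pow_pos ha 2]

/-- The dominant energy condition for the electromagnetic field `(e, b)`, against the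
causal vectors `(1, n)` and `(1, u)`. -/
theorem electromagnetic_dominant_energy {e b n u : Fin 3 → ℝ} (hn : n ⬝ᵥ n ≤ 1)
    (hu : u ⬝ᵥ u < 1) :
    0 ≤ (e ⬝ᵥ e + b ⬝ᵥ b) / 2 * (1 - u ⬝ᵥ n) + (e ⨯₃ b) ⬝ᵥ n - u ⬝ᵥ (e ⨯₃ b)
      + (e ⬝ᵥ u) * (e ⬝ᵥ n) + (b ⬝ᵥ u) * (b ⬝ᵥ n) := by
  have h0 : 0 ≤ (e ⬝ᵥ e + b ⬝ᵥ b) / 2 + (e ⨯₃ b) ⬝ᵥ n := by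
    have h1 := dot_self_nonneg (e + b ⨯₃ n)
    have h2 := mul_nonneg (dot_self_nonneg b) (sub_nonneg.2 hn)
    have h3 := sq_nonneg (b ⬝ᵥ n)
    have h4 : (e ⬝ᵥ e + b ⬝ᵥ b) / 2 + (e ⨯₃ b) ⬝ᵥ n
        = ((e + b ⨯₃ n) ⬝ᵥ (e + b ⨯₃ n) + b ⬝ᵥ b * (1 - n ⬝ᵥ n) + (b ⬝ᵥ n) ^ 2) / 2 := by
      simp only [cross_apply, dotProduct, Fin.sum_univ_three, Pi.add_apply, Matrix.cons_val]
      ring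
    rw [h4]; linarith
  -- The energy-momentum tensor `T` of the field, applied to the causal vector built from `n`, has
  -- this spatial part, and its time part is the left side of `h0`. The square of `T` is a multiple
  -- of the identity, so the Lorentz norm of `n` is only scaled, by the invariant `((|e|² - |b|²) /
  -- 2)² + (e · b)²`. Hence the image is again causal.
  have h1 := dot_le_of_causal (x := e ⨯₃ b + ((e ⬝ᵥ e + b ⬝ᵥ b) / 2) • n - (e ⬝ᵥ n) • e
    - (b ⬝ᵥ n) • b) hu h0 ?_
  · simp only [dotProduct_sub, dotProduct_add, dotProduct_smul, smul_eq_mul] at h1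
    rw [dotProduct_comm e u, dotProduct_comm b u]
    linarith
  · have h2 : 0 ≤ (((e ⬝ᵥ e - b ⬝ᵥ b) / 2) ^ 2 + (e ⬝ᵥ b) ^ 2) * (1 - n ⬝ᵥ n) :=
      mul_nonneg (by positivity) (sub_nonneg.2 hn)
    refine sub_nonneg.1 (h2.trans_eq ?_)
    simp only [cross_apply, dotProduct, Fin.sum_univ_three, Pi.add_apply, Pi.sub_apply,
      Pi.smul_apply, smul_eq_mul, Matrix.cons_val]
    ring

/-- The gas pressure contribution is positive. -/
theorem pressure_dominant_energy {v n u : Fin 3 → ℝ} (hv : v ⬝ᵥ v < 1) (hn : n ⬝ᵥ n ≤ 1)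
    (hu : u ⬝ᵥ u < 1) :
    (1 - v ⬝ᵥ v) * (1 + n ⬝ᵥ u) < 2 * (1 + n ⬝ᵥ v) * (1 - v ⬝ᵥ u) := by
  have h0 : 0 < 1 + 2 * (n ⬝ᵥ v) + v ⬝ᵥ v := by
    have h1 := dot_sq_le n v
    have h2 := mul_le_mul_of_nonneg_right hn (dot_self_nonneg v)
    -- Since `|n · v| ≤ |v|`, the expression is at least `(1 - |v|)²`.
    by_contra! h
    nlinarith [pow_pos (sub_pos.2 hv) 2]
  -- With `X = (1, v)`, `N = (1, -n)` and the Lorentz product, this is the spatial part of `2 ⟨X, N⟩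
  -- X - ⟨X, X⟩ N`, which is `⟨X, X⟩` times the reflection of `N` in the line of `X`. It is
  -- therefore causal, and its time part is the quantity in `h0`.
  have h1 := dot_lt_of_causal (x := (2 * (1 + n ⬝ᵥ v)) • v + (1 - v ⬝ᵥ v) • n) hu h0 ?_
  · rw [dotProduct_comm] at h1
    simp only [add_dotProduct, smul_dotProduct, smul_eq_mul] at h1
    linarith
  · have h2 : 0 ≤ (1 - v ⬝ᵥ v) ^ 2 * (1 - n ⬝ᵥ n) :=
      mul_nonneg (by positivity) (sub_nonneg.2 hn)
    refine sub_nonneg.1 (h2.trans_eq ?_)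
    simp only [dotProduct_add, add_dotProduct, dotProduct_smul, smul_dotProduct, smul_eq_mul,
      dotProduct_comm v n]
    ring

/-- The reverse Cauchy–Schwarz inequality for the timelike vectors `(1, v)` and `(1, u)`. It follows
from the arithmetic-geometric mean inequality and `|v - u|² ≥ 0`. -/
theorem sqrt_mul_sqrt_le_one_sub_dot {v u : Fin 3 → ℝ} (hv : v ⬝ᵥ v < 1) (hu : u ⬝ᵥ u < 1) :
    Real.sqrt (1 - v ⬝ᵥ v) * Real.sqrt (1 - u ⬝ᵥ u) ≤ 1 - v ⬝ᵥ u := by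
  have h := dot_self_nonneg (v - u)
  simp only [dotProduct_sub, sub_dotProduct, dotProduct_comm u v] at h
  have h1 := sq_nonneg (Real.sqrt (1 - v ⬝ᵥ v) - Real.sqrt (1 - u ⬝ᵥ u))
  nlinarith [Real.sq_sqrt (sub_pos.2 hv).le, Real.sq_sqrt (sub_pos.2 hu).le]

/-- The magnetic part of the flux inequality is an electromagnetic energy flux. -/
theorem magnetic_part_eq (v B u b n : Fin 3 → ℝ) :
    ((B ⬝ᵥ B - ((1 - v ⬝ᵥ v) * (B ⬝ᵥ B) + (v ⬝ᵥ B) ^ 2) / 2)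
        + n ⬝ᵥ ((B ⬝ᵥ B) • v - (v ⬝ᵥ B) • B))
      - u ⬝ᵥ (((B ⬝ᵥ B) • v - (v ⬝ᵥ B) • B)
        + ((n ⬝ᵥ v) • ((B ⬝ᵥ B) • v - (v ⬝ᵥ B) • B)
          - (n ⬝ᵥ B) • ((1 - v ⬝ᵥ v) • B + (v ⬝ᵥ B) • v)
          + (((1 - v ⬝ᵥ v) * (B ⬝ᵥ B) + (v ⬝ᵥ B) ^ 2) / 2) • n))
      - ((1 - u ⬝ᵥ u) • b + (u ⬝ᵥ b) • u) ⬝ᵥ (B + ((n ⬝ᵥ v) • B - (n ⬝ᵥ B) • v))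
      + dualPressure u b * (1 + n ⬝ᵥ u) - (n ⬝ᵥ B) * (u ⬝ᵥ b)
    = ((u ⨯₃ b - v ⨯₃ B) ⬝ᵥ (u ⨯₃ b - v ⨯₃ B) + (B - b) ⬝ᵥ (B - b)) / 2 * (1 - u ⬝ᵥ n)
      + ((u ⨯₃ b - v ⨯₃ B) ⨯₃ (B - b)) ⬝ᵥ n - u ⬝ᵥ ((u ⨯₃ b - v ⨯₃ B) ⨯₃ (B - b))
      + ((u ⨯₃ b - v ⨯₃ B) ⬝ᵥ u) * ((u ⨯₃ b - v ⨯₃ B) ⬝ᵥ n)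
      + ((B - b) ⬝ᵥ u) * ((B - b) ⬝ᵥ n) := by
  simp only [dualPressure, cross_apply, dotProduct, Fin.sum_univ_three, Pi.add_apply,
    Pi.sub_apply, Pi.smul_apply, smul_eq_mul, Matrix.cons_val]
  ring

/-! ### The flux inequality -/

/-- The flux `∑ₖ nₖ F_k` in the direction `n`, in closed form. -/
theorem PrimState.sum_flux (Γ : ℝ) (n : Fin 3 → ℝ) (V : PrimState) :
    ∑ k, n k • V.flux Γ k = (V.massDensity * (n ⬝ᵥ V.v),
      (n ⬝ᵥ V.v) • V.momentum Γ - (n ⬝ᵥ V.B) • (V.lorentz⁻¹ ^ 2 • V.B + (V.v ⬝ᵥ V.B) • V.v)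
        + V.totalPressure • n,
      (n ⬝ᵥ V.v) • V.B - (n ⬝ᵥ V.B) • V.v, n ⬝ᵥ V.momentum Γ) := by
  simp only [PrimState.flux, Fin.sum_univ_three, dotProduct]
  refine Prod.ext ?_ (Prod.ext ?_ (Prod.ext ?_ ?_))
  · simp
    ring
  · ext i
    fin_cases i <;> simp <;> ring
  · ext i
    simp
    ring
  · simp

theorem PrimState.Admissible.dot_v_lt_one {V : PrimState} (hV : V.Admissible) :
    V.v ⬝ᵥ V.v < 1 := by
  have hs : V.speed ^ 2 = V.v ⬝ᵥ V.v := Real.sq_sqrt (dot_self_nonneg _)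
  have hs0 : 0 ≤ V.speed := Real.sqrt_nonneg _
  have := hV.2.2
  rw [← hs]; nlinarith

theorem PrimState.lorentz_eq (V : PrimState) :
    V.lorentz = (Real.sqrt (1 - V.v ⬝ᵥ V.v))⁻¹ := by
  rw [PrimState.lorentz, PrimState.speed, Real.sq_sqrt (dot_self_nonneg _), one_div]

/-- The flux inequality behind the generalized Lax–Friedrichs splitting. -/
theorem dualPairing_flux_pos {Γ : ℝ} (hΓ : 1 < Γ) (hΓ2 : Γ ≤ 2) {V : PrimState}
    (hV : V.Admissible) {n u : Fin 3 → ℝ} (hn : n ⬝ᵥ n ≤ 1) (hu : u ⬝ᵥ u < 1)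
    (b : Fin 3 → ℝ) :
    0 < dualPairing u b (V.toCons Γ + ∑ k, n k • V.flux Γ k)
      + dualPressure u b * (1 + n ⬝ᵥ u) - (n ⬝ᵥ V.B) * (u ⬝ᵥ b) := by
  have hv := hV.dot_v_lt_one
  obtain ⟨hr, hp, -⟩ := hV
  have hw : 0 < 1 - V.v ⬝ᵥ V.v := sub_pos.2 hv
  set s := Real.sqrt (1 - V.v ⬝ᵥ V.v) with hs
  have hs0 : 0 < s := Real.sqrt_pos.2 hw
  have hss : s ^ 2 = 1 - V.v ⬝ᵥ V.v := Real.sq_sqrt hw.le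
  have hL : V.lorentz = s⁻¹ := V.lorentz_eq
  have hLi : V.lorentz⁻¹ ^ 2 = 1 - V.v ⬝ᵥ V.v := by rw [hL, inv_inv, hss]
  -- The electric field of ideal magnetohydrodynamics is `-v × B`, so `e` and `b` here are the
  -- differences between the fields of the state and those of the test state.
  have mag := electromagnetic_dominant_energy (e := u ⨯₃ b - V.v ⨯₃ V.B) (b := V.B - b) hn hu
  rw [← magnetic_part_eq] at mag
  set ξ := V.rho * V.enthalpy Γ * V.lorentz ^ 2 with hξ
  -- The bound `Γ ≤ 2` enters here; the factor 2 is the one in `pressure_dominant_energy`.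
  have hξw : V.rho + 2 * V.p ≤ ξ * s ^ 2 := by
    have h1 : ξ * s ^ 2 = V.rho * V.enthalpy Γ := by
      rw [hξ, hL]; field_simp
    have h2 : V.rho * V.enthalpy Γ = V.rho + Γ / (Γ - 1) * V.p := by
      have : Γ - 1 ≠ 0 := by linarith
      unfold PrimState.enthalpy PrimState.internalEnergy
      field_simp
      ring
    have h3 : 2 ≤ Γ / (Γ - 1) := by
      rw [le_div_iff₀ (by linarith)]; linarith
    rw [h1, h2]
    gcongr
  have fluid : 0 < (1 + n ⬝ᵥ V.v) * (ξ * (1 - V.v ⬝ᵥ u)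
      - V.massDensity * Real.sqrt (1 - u ⬝ᵥ u)) - V.p * (1 + n ⬝ᵥ u) := by
    have hD : V.massDensity * s = V.rho := by
      rw [PrimState.massDensity, hL, inv_mul_cancel_right₀ hs0.ne']
    have hnv : 0 < 1 + n ⬝ᵥ V.v := by
      have := dot_lt_of_causal (x := -n) (a := 1) hv one_pos (by simpa using hn)
      rw [dotProduct_neg, dotProduct_comm] at this
      linarith
    have cs := sqrt_mul_sqrt_le_one_sub_dot hv hu
    rw [← hs] at cs
    have hvu : 0 ≤ 1 - V.v ⬝ᵥ u := le_trans (by positivity) cs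
    have pr := pressure_dominant_energy hv hn hu
    rw [← hss] at pr
    have key : 0 < (1 + n ⬝ᵥ V.v) * (ξ * s ^ 2 * (1 - V.v ⬝ᵥ u)
      - V.rho * (s * Real.sqrt (1 - u ⬝ᵥ u))) - V.p * (s ^ 2 * (1 + n ⬝ᵥ u)) := by
      have k1 := mul_le_mul_of_nonneg_right hξw hvu
      have k2 := mul_le_mul_of_nonneg_left cs hr.le
      have k3 := mul_lt_mul_of_pos_left pr hp
      have k4 : (1 + n ⬝ᵥ V.v) * (2 * V.p * (1 - V.v ⬝ᵥ u)) ≤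
          (1 + n ⬝ᵥ V.v) * (ξ * s ^ 2 * (1 - V.v ⬝ᵥ u)
            - V.rho * (s * Real.sqrt (1 - u ⬝ᵥ u))) :=
        mul_le_mul_of_nonneg_left (by linarith) hnv.le
      linarith
    -- Multiplication by `s² = W⁻²` turns `ξ` into `ρ h` and `D s` into `ρ`.
    refine pos_of_mul_pos_right (a := s ^ 2) ?_ (by positivity)
    refine key.trans_eq ?_
    linear_combination ((1 + n ⬝ᵥ V.v) * s * Real.sqrt (1 - u ⬝ᵥ u)) * hD
  have split : dualPairing u b (V.toCons Γ + ∑ k, n k • V.flux Γ k)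
        + dualPressure u b * (1 + n ⬝ᵥ u) - (n ⬝ᵥ V.B) * (u ⬝ᵥ b)
      = ((1 + n ⬝ᵥ V.v) * (ξ * (1 - V.v ⬝ᵥ u)
          - V.massDensity * Real.sqrt (1 - u ⬝ᵥ u)) - V.p * (1 + n ⬝ᵥ u))
        + (((V.B ⬝ᵥ V.B - ((1 - V.v ⬝ᵥ V.v) * (V.B ⬝ᵥ V.B) + (V.v ⬝ᵥ V.B) ^ 2) / 2)
        + n ⬝ᵥ ((V.B ⬝ᵥ V.B) • V.v - (V.v ⬝ᵥ V.B) • V.B))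
      - u ⬝ᵥ (((V.B ⬝ᵥ V.B) • V.v - (V.v ⬝ᵥ V.B) • V.B)
        + ((n ⬝ᵥ V.v) • ((V.B ⬝ᵥ V.B) • V.v - (V.v ⬝ᵥ V.B) • V.B)
          - (n ⬝ᵥ V.B) • ((1 - V.v ⬝ᵥ V.v) • V.B + (V.v ⬝ᵥ V.B) • V.v)
          + (((1 - V.v ⬝ᵥ V.v) * (V.B ⬝ᵥ V.B) + (V.v ⬝ᵥ V.B) ^ 2) / 2) • n))
      - ((1 - u ⬝ᵥ u) • b + (u ⬝ᵥ b) • u) ⬝ᵥ (V.B + ((n ⬝ᵥ V.v) • V.B - (n ⬝ᵥ V.B) • V.v))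
      + dualPressure u b * (1 + n ⬝ᵥ u) - (n ⬝ᵥ V.B) * (u ⬝ᵥ b)) := by
    rw [PrimState.sum_flux, PrimState.toCons, PrimState.energy, PrimState.momentum, ← hξ,
      PrimState.totalPressure, PrimState.magneticPressure, hLi]
    simp only [dualPairing, LinearMap.coe_mk, AddHom.coe_mk, Prod.fst_add, Prod.snd_add,
      dotProduct_add, dotProduct_sub, dotProduct_smul, smul_eq_mul, dotProduct_comm u V.v,
      dotProduct_comm u n]
    ring
  rw [split]
  linarith

/-! ### Recovery of the primitive variables from the affine conditions -/

open Filter Set Topology in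
/-- A state `(D, m, B, E)` with `D > 0` whose pairings `U · n* + p_m*` are all positive is
admissible. -/
theorem mem_admissibleSet_of_dualPairing_pos {Γ : ℝ} (hΓ : 1 < Γ) (hΓ2 : Γ ≤ 2) {U : ConsState}
    (hD : 0 < U.1)
    (hU : ∀ v B : Fin 3 → ℝ, v ⬝ᵥ v < 1 → 0 < dualPairing v B U + dualPressure v B) :
    U ∈ admissibleSet Γ := by
  obtain ⟨D, m, B, E⟩ := U
  simp only at hD
  set b := B ⬝ᵥ B with hb
  have hb0 : 0 ≤ b := dot_self_nonneg B
  set τ := m ⬝ᵥ B with hτ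
  set k := (Γ - 1) / Γ with hk
  have hk0 : 0 < k := div_pos (by linarith) (by linarith)
  have hk1 : k ≤ 1 / 2 := by
    rw [hk, div_le_iff₀ (by linarith)]; linarith
  -- The unknown is `x = ρ h W²`. The equations for `m` and `D` and the `Γ`-law determine `v`, `w =
  -- W⁻²` and `p` from `x`, and `e x` is the resulting energy. It remains to solve `e x = E` with `w
  -- x > 0` and `p x > 0`; both signs follow from `x² w(x) > D²`.
  let v : ℝ → Fin 3 → ℝ := fun x => (x + b)⁻¹ • (m + (τ / x) • B)
  let w : ℝ → ℝ := fun x => 1 - v x ⬝ᵥ v x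
  let p : ℝ → ℝ := fun x => k * (x * w x - D * Real.sqrt (w x))
  let e : ℝ → ℝ := fun x => x - p x - (w x * b + (τ / x) ^ 2) / 2 + b
  have hvB : ∀ x, 0 < x → v x ⬝ᵥ B = τ / x := by
    intro x hx
    have : x + b ≠ 0 := by positivity
    simp only [v, smul_dotProduct, add_dotProduct, smul_eq_mul, ← hb, ← hτ]
    field_simp
  have hm : ∀ x, 0 < x → (x + b) • v x - (τ / x) • B = m := by
    intro x hx
    have : x + b ≠ 0 := by positivity
    simp only [v, smul_smul, mul_inv_cancel₀ this, one_smul, add_sub_cancel_right]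
  have hvc : ContinuousOn v (Ioi 0) := by
    intro x hx
    have hx' : x ≠ 0 := (mem_Ioi.1 hx).ne'
    have hxb : x + b ≠ 0 := by have := mem_Ioi.1 hx; positivity
    apply ContinuousAt.continuousWithinAt
    simp only [v]
    fun_prop (disch := assumption)
  have hwc : ContinuousOn w (Ioi 0) := by
    simp only [w, dotProduct, Fin.sum_univ_three]
    have := fun i => (continuousOn_pi.1 hvc) i
    fun_prop
  have hpc : ContinuousOn p (Ioi 0) := by
    simp only [p]
    fun_prop
  have hec : ContinuousOn e (Ioi 0) := by
    simp only [e]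
    have : ContinuousOn (fun x : ℝ => τ / x) (Ioi 0) :=
      continuousOn_const.div continuousOn_id fun x hx => (mem_Ioi.1 hx).ne'
    fun_prop
  have hw1 : ∀ x, w x ≤ 1 := fun x => by
    have := dot_self_nonneg (v x)
    simp only [w]; linarith
  have hlim : Tendsto w atTop (𝓝 1) := by
    have h1 : Tendsto (fun x : ℝ => (x + b)⁻¹) atTop (𝓝 0) :=
      tendsto_inv_atTop_zero.comp (tendsto_atTop_add_const_right _ _ tendsto_id)
    have h2 : Tendsto (fun x : ℝ => τ / x) atTop (𝓝 0) := tendsto_const_nhds.div_atTop tendsto_id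
    have h3 : Tendsto v atTop (𝓝 0) := by
      have := h1.smul ((tendsto_const_nhds (x := m)).add (h2.smul_const B))
      simpa only [zero_smul, add_zero] using this
    have h4 := (Continuous.tendsto (f := fun y : Fin 3 → ℝ => 1 - y ⬝ᵥ y)
      (by simp only [dotProduct, Fin.sum_univ_three]; fun_prop) 0).comp h3
    simpa [Function.comp_def] using h4
  -- the largest root of `x² w(x) = D²`
  obtain ⟨x₀, hx₀, hx₀w, hx₀p⟩ : ∃ x₀, 0 < x₀ ∧ x₀ ^ 2 * w x₀ = D ^ 2 ∧
      ∀ x, x₀ < x → D ^ 2 < x ^ 2 * w x := by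
    have hg : Tendsto (fun x => x ^ 2 * w x) atTop atTop :=
      (tendsto_pow_atTop two_ne_zero).atTop_mul_pos one_pos hlim
    obtain ⟨R, hR⟩ := eventually_atTop.1 (hg.eventually_gt_atTop (D ^ 2))
    have hgc : ContinuousOn (fun x => x ^ 2 * w x) (Ioi 0) := by fun_prop
    have hsub : ∀ a c, D / 2 ≤ a → Icc a c ⊆ Ioi (0 : ℝ) := fun a c ha x hx =>
      mem_Ioi.2 (by linarith [hx.1])
    -- The lower end stays away from the singularity at `0`, and it belongs to `S` because `w ≤ 1`.
    set S := Icc (D / 2) R ∩ {x | x ^ 2 * w x ≤ D ^ 2}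
    have hScl : IsClosed S :=
      (hgc.mono (hsub _ _ le_rfl)).preimage_isClosed_of_isClosed isClosed_Icc isClosed_Iic
    have hSc : IsCompact S := isCompact_Icc.of_isClosed_subset hScl inter_subset_left
    have hhalf : (D / 2) ^ 2 * w (D / 2) ≤ D ^ 2 := by
      nlinarith [hw1 (D / 2), sq_nonneg D, mul_le_mul_of_nonneg_left (hw1 (D / 2)) (sq_nonneg D)]
    have hne : S.Nonempty := by
      refine ⟨D / 2, ⟨le_rfl, ?_⟩, hhalf⟩
      by_contra! h
      exact absurd (hR _ h.le) hhalf.not_gt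
    obtain ⟨x₀, hx₀, hmax⟩ := hSc.exists_isGreatest hne
    have hgt : ∀ x, x₀ < x → D ^ 2 < x ^ 2 * w x := by
      intro x hx
      by_contra! h
      have : x ≤ R := by
        by_contra! h'
        exact absurd (hR _ h'.le) h.not_gt
      exact absurd (hmax ⟨⟨hx₀.1.1.trans hx.le, this⟩, h⟩) hx.not_ge
    refine ⟨x₀, by linarith [hx₀.1.1], le_antisymm hx₀.2 ?_, hgt⟩
    have hc : ContinuousWithinAt (fun x => x ^ 2 * w x) (Ioi x₀) x₀ :=
      (hgc.continuousAt (Ioi_mem_nhds (by linarith [hx₀.1.1]))).continuousWithinAt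
    exact ge_of_tendsto hc (eventually_nhdsWithin_of_forall fun x hx => (hgt x hx).le)
  have hw₀ : 0 < w x₀ := by
    by_contra! h
    nlinarith [pow_pos hx₀ 2, pow_pos hD 2]
  have hs₀ : x₀ * Real.sqrt (w x₀) = D := by
    refine (sq_eq_sq₀ (by positivity) hD.le).1 ?_
    rw [mul_pow, Real.sq_sqrt hw₀.le, hx₀w]
  have hp₀ : p x₀ = 0 := by
    simp only [p]
    rw [← hs₀]
    linear_combination -k * x₀ * Real.mul_self_sqrt hw₀.le
  -- the test state with vanishing pressure bounds the energy from below
  have hE : e x₀ < E := by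
    have h := hU (v x₀) B (by simpa [w] using hw₀)
    simp only [dualPairing, dualPressure, LinearMap.coe_mk, AddHom.coe_mk, hvB x₀ hx₀, ← hb] at h
    have h1 : v x₀ ⬝ᵥ m = (x₀ + b) * (1 - w x₀) - (τ / x₀) ^ 2 := by
      conv_lhs => rw [← hm x₀ hx₀]
      simp only [dotProduct_sub, dotProduct_smul, smul_eq_mul, hvB x₀ hx₀, w]
      ring
    have h2 : ((1 - v x₀ ⬝ᵥ v x₀) • B + (τ / x₀) • v x₀) ⬝ᵥ B = w x₀ * b + (τ / x₀) ^ 2 := by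
      simp only [add_dotProduct, smul_dotProduct, smul_eq_mul, hvB x₀ hx₀, ← hb, w]
      ring
    rw [h1, h2] at h
    change 0 < E - Real.sqrt (w x₀) * D - _ - _ + (w x₀ * b + _) / 2 at h
    have h3 : Real.sqrt (w x₀) * D = x₀ * w x₀ := by
      rw [← hs₀]
      linear_combination x₀ * Real.mul_self_sqrt hw₀.le
    simp only [e, hp₀]
    linarith
  obtain ⟨x, hx, hxE⟩ : ∃ x, x₀ < x ∧ e x = E := by
    obtain ⟨y, hy, hyE⟩ : ∃ y, x₀ < y ∧ E ≤ e y := by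
      -- Since `p y ≤ y / 2` and `w y ≤ 1`, `e y ≥ y / 2 - (τ / x₀)² / 2`, which exceeds `|E|` for
      -- this `y`.
      set y := x₀ + 2 * |E| + (τ / x₀) ^ 2 + 1 with hy
      have hyx : x₀ < y := by
        have : 0 < 2 * |E| + (τ / x₀) ^ 2 + 1 := by positivity
        linarith
      have hy0 : 0 < y := hx₀.trans hyx
      refine ⟨y, hyx, ?_⟩
      have h1 : (τ / y) ^ 2 ≤ (τ / x₀) ^ 2 := by
        rw [div_pow, div_pow]; gcongr
      have h2 : p y ≤ y / 2 := by
        have h3 : y * w y - D * Real.sqrt (w y) ≤ y := by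
          have := mul_le_mul_of_nonneg_left (hw1 y) hy0.le
          have : 0 ≤ D * Real.sqrt (w y) := by positivity
          linarith
        calc p y ≤ k * y := mul_le_mul_of_nonneg_left h3 hk0.le
          _ ≤ 1 / 2 * y := mul_le_mul_of_nonneg_right hk1 hy0.le
          _ = y / 2 := by ring
      have h4 := mul_le_mul_of_nonneg_right (hw1 y) hb0
      have := le_abs_self E
      simp only [e]
      linarith
    obtain ⟨x, hx, hxE⟩ := intermediate_value_Icc hy.le
      (hec.mono fun z hz => mem_Ioi.2 (hx₀.trans_le hz.1)) ⟨hE.le, hyE⟩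
    refine ⟨x, lt_of_le_of_ne hx.1 ?_, hxE⟩
    rintro rfl
    exact hE.ne hxE
  have hx0 := hx₀.trans hx
  have hxw := hx₀p x hx
  have hw0 : 0 < w x := by
    by_contra! h
    nlinarith [pow_pos hx0 2, pow_pos hD 2]
  set s := Real.sqrt (w x) with hs
  have hs0 : 0 < s := Real.sqrt_pos.2 hw0
  have hss : s ^ 2 = w x := Real.sq_sqrt hw0.le
  have hDs : D < x * s := by
    rw [← hss] at hxw
    exact lt_of_pow_lt_pow_left₀ 2 (by positivity) (by linarith)
  have hp : 0 < p x := by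
    have : p x = k * (s * (x * s - D)) := by
      simp only [p]; rw [← hs, ← hss]; ring
    rw [this]
    have := sub_pos.2 hDs
    positivity
  set V : PrimState := ⟨D * s, v x, B, p x⟩
  have hsp : V.speed ^ 2 = v x ⬝ᵥ v x := Real.sq_sqrt (dot_self_nonneg _)
  have hsp1 : V.speed < 1 := by
    refine lt_of_pow_lt_pow_left₀ 2 zero_le_one ?_
    rw [hsp, one_pow]
    simpa [w] using hw0
  have hL : V.lorentz = s⁻¹ := by
    rw [PrimState.lorentz, hsp, one_div]
  have hξ : V.rho * V.enthalpy Γ * V.lorentz ^ 2 = x := by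
    have h1 : V.rho * V.enthalpy Γ = D * s + p x / k := by
      have : Γ - 1 ≠ 0 := by linarith
      have : Γ ≠ 0 := by linarith
      simp only [PrimState.enthalpy, PrimState.internalEnergy, hk, V]
      field_simp
      ring
    rw [h1, hL]
    simp only [p]
    rw [← hs, ← hss]
    field_simp
    ring
  refine ⟨V, ⟨mul_pos hD hs0, hp, hsp1⟩, ?_⟩
  have hmom : V.momentum Γ = m := by
    rw [PrimState.momentum, hξ]
    change x • v x + b • v x - (v x ⬝ᵥ B) • B = m
    rw [hvB x hx0, ← add_smul, hm x hx0]
  have hen : V.energy Γ = E := by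
    rw [PrimState.energy, hξ, PrimState.totalPressure, PrimState.magneticPressure, hL, inv_inv,
      hss, ← hxE]
    change x - (p x + (w x * b + (v x ⬝ᵥ B) ^ 2) / 2) + b = e x
    rw [hvB x hx0]
    simp only [e]
    ring
  have hmass : V.massDensity = D := by
    rw [PrimState.massDensity, hL]
    change D * s * s⁻¹ = D
    field_simp
  rw [PrimState.toCons, hmom, hen, hmass]

/-! ### Averaging over the faces of a cell -/

theorem dualPairing_sub_flux_pos {Γ : ℝ} (hΓ : 1 < Γ) (hΓ2 : Γ ≤ 2) {U : ConsState}
    (hU : U ∈ admissibleSet Γ) {n u : Fin 3 → ℝ} (hn : n ⬝ᵥ n ≤ 1) (hu : u ⬝ᵥ u < 1)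
    (b : Fin 3 → ℝ) {θ : ℝ} (hθ0 : 0 ≤ θ) (hθ1 : θ ≤ 1) :
    0 < dualPairing u b (U - θ • ∑ k, n k • flux Γ k U)
      + dualPressure u b * (1 - θ * (n ⬝ᵥ u)) + θ * (n ⬝ᵥ magneticField U) * (u ⬝ᵥ b) := by
  obtain ⟨V, hV, rfl⟩ := hU
  -- The flux inequality is used with the direction `-θ n`, still of length at most 1. With `θ =
  -- α⁻¹` this is where `α ≥ 1`, the speed of light, matters.
  have hN : (-θ • n) ⬝ᵥ (-θ • n) ≤ 1 := by
    simp only [dotProduct_smul, smul_dotProduct, smul_eq_mul]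
    linarith [mul_le_mul_of_nonneg_left hn (sq_nonneg θ), pow_le_one₀ hθ0 hθ1 (n := 2)]
  have h := dualPairing_flux_pos hΓ hΓ2 hV hN hu b
  have e : V.toCons Γ - θ • ∑ k, n k • flux Γ k (V.toCons Γ)
      = V.toCons Γ + ∑ k, (-θ • n) k • V.flux Γ k := by
    simp only [flux, prim_toCons hΓ hΓ2 hV, Pi.smul_apply, smul_eq_mul, mul_smul, neg_smul,
      Finset.sum_neg_distrib, ← Finset.smul_sum, sub_eq_add_neg]
  rw [e]
  simp only [smul_dotProduct, smul_eq_mul] at h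
  change 0 < _ + _ + θ * (n ⬝ᵥ V.B) * _
  linarith

theorem massDensity_sub_flux_pos {Γ : ℝ} (hΓ : 1 < Γ) (hΓ2 : Γ ≤ 2) {U : ConsState}
    (hU : U ∈ admissibleSet Γ) {n : Fin 3 → ℝ} (hn : n ⬝ᵥ n ≤ 1) {θ : ℝ} (hθ0 : 0 ≤ θ)
    (hθ1 : θ ≤ 1) : 0 < (U - θ • ∑ k, n k • flux Γ k U).1 := by
  obtain ⟨V, hV, rfl⟩ := hU
  have hD : 0 < V.massDensity := by
    obtain ⟨-, -, -, -, hD, -⟩ := hV.relations hΓ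
    exact hD
  have e : (V.toCons Γ - θ • ∑ k, n k • flux Γ k (V.toCons Γ)).1
      = V.massDensity * (1 - θ * (n ⬝ᵥ V.v)) := by
    simp only [flux, prim_toCons hΓ hΓ2 hV, PrimState.sum_flux, Prod.fst_sub, Prod.smul_fst,
      smul_eq_mul]
    change V.massDensity - _ = _
    ring
  have h := dot_lt_of_causal (x := n) (a := 1) hV.dot_v_lt_one one_pos (by simpa using hn)
  rw [dotProduct_comm] at h
  rw [e]
  refine mul_pos hD ?_
  rcases hθ0.eq_or_lt with rfl | hθ
  · simp
  · linarith [mul_lt_mul_of_pos_left h hθ]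

/-- Generalized Lax–Friedrichs splitting over faces with measures `l j` and normals `n j`, `|n j| ≤ 1`,
that close up, for states satisfying the discrete divergence-free condition. -/
theorem laxFriedrichs_mem_admissibleSet {Γ : ℝ} (hΓ : 1 < Γ) (hΓ2 : Γ ≤ 2) {ι κ : Type*}
    [Fintype ι] [Fintype κ] [Nonempty κ] {ω : ι → ℝ} (hω : ∀ i, 0 < ω i) (hω1 : ∑ i, ω i = 1)
    {α : ℝ} (hα : 1 ≤ α) {l : κ → ℝ} (hl : ∀ j, 0 < l j) {n : κ → Fin 3 → ℝ}
    (hn : ∀ j, n j ⬝ᵥ n j ≤ 1) (hclosed : ∑ j, l j • n j = 0) {U : ι → κ → ConsState}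
    (hU : ∀ i j, U i j ∈ admissibleSet Γ)
    (hdiv : ∑ j, l j * ∑ i, ω i * (n j ⬝ᵥ magneticField (U i j)) = 0) :
    (1 / ∑ j, l j) • ∑ j, l j • ∑ i, ω i •
      (U i j - α⁻¹ • ∑ k, n j k • flux Γ k (U i j)) ∈ admissibleSet Γ := by
  have hα0 : 0 ≤ α⁻¹ := inv_nonneg.2 (by linarith)
  have hα1 : α⁻¹ ≤ 1 := inv_le_one_of_one_le₀ hα
  have hι : Nonempty ι := by
    by_contra h
    rw [not_nonempty_iff] at h
    simp at hω1
  have hS : 0 < ∑ j, l j := Finset.sum_pos (fun j _ => hl j) Finset.univ_nonempty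
  have avg_pos : ∀ f : ι → κ → ℝ, (∀ i j, 0 < f i j) → 0 < ∑ j, l j * ∑ i, ω i * f i j :=
    fun f hf => Finset.sum_pos (fun j _ => mul_pos (hl j)
      (Finset.sum_pos (fun i _ => mul_pos (hω i) (hf i j)) Finset.univ_nonempty))
      Finset.univ_nonempty
  refine mem_admissibleSet_of_dualPairing_pos hΓ hΓ2 ?_ fun u b hu => ?_
  · have h := avg_pos _ fun i j => massDensity_sub_flux_pos hΓ hΓ2 (hU i j) (hn j) hα0 hα1
    have := mul_pos (one_div_pos.2 hS) h
    simpa only [Prod.smul_fst, Prod.fst_sum, smul_eq_mul] using this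
  · have h := avg_pos _ fun i j => dualPairing_sub_flux_pos hΓ hΓ2 (hU i j) (hn j) hu b hα0 hα1
    have hclosed' : ∑ j, l j * (n j ⬝ᵥ u) = 0 := by
      have := congrArg (· ⬝ᵥ u) hclosed
      simpa only [sum_dotProduct, smul_dotProduct, smul_eq_mul, zero_dotProduct] using this
    have e1 : ∀ j, ∑ i, ω i * (dualPairing u b (U i j - α⁻¹ • ∑ k, n j k • flux Γ k (U i j))
          + dualPressure u b * (1 - α⁻¹ * (n j ⬝ᵥ u))
          + α⁻¹ * (n j ⬝ᵥ magneticField (U i j)) * (u ⬝ᵥ b))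
        = ∑ i, ω i * dualPairing u b (U i j - α⁻¹ • ∑ k, n j k • flux Γ k (U i j))
          + dualPressure u b * (1 - α⁻¹ * (n j ⬝ᵥ u))
          + α⁻¹ * (u ⬝ᵥ b) * ∑ i, ω i * (n j ⬝ᵥ magneticField (U i j)) := by
      intro j
      simp only [mul_add, Finset.sum_add_distrib]
      congr 1
      · rw [← Finset.sum_mul, hω1, one_mul]
      · rw [Finset.mul_sum]
        exact Finset.sum_congr rfl fun i _ => by ring
    -- The two defect terms cancel only in the sum over all faces: one by `hclosed'`, the other by
    -- `hdiv`.
    have e2 : ∑ j, l j * ∑ i, ω i *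
          (dualPairing u b (U i j - α⁻¹ • ∑ k, n j k • flux Γ k (U i j))
          + dualPressure u b * (1 - α⁻¹ * (n j ⬝ᵥ u))
          + α⁻¹ * (n j ⬝ᵥ magneticField (U i j)) * (u ⬝ᵥ b))
        = ∑ j, l j * ∑ i, ω i * dualPairing u b (U i j - α⁻¹ • ∑ k, n j k • flux Γ k (U i j))
          + (∑ j, l j) * dualPressure u b := by
      calc _ = ∑ j, (l j * ∑ i, ω i *
              dualPairing u b (U i j - α⁻¹ • ∑ k, n j k • flux Γ k (U i j))
            + l j * dualPressure u b - dualPressure u b * α⁻¹ * (l j * (n j ⬝ᵥ u))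
            + α⁻¹ * (u ⬝ᵥ b) * (l j * ∑ i, ω i * (n j ⬝ᵥ magneticField (U i j)))) :=
            Finset.sum_congr rfl fun j _ => by rw [e1]; ring
        _ = _ := by
          rw [Finset.sum_add_distrib, Finset.sum_sub_distrib, Finset.sum_add_distrib,
            ← Finset.mul_sum, ← Finset.mul_sum, hclosed', hdiv, ← Finset.sum_mul]
          ring
    rw [e2] at h
    simp only [map_smul, map_sum, smul_eq_mul]
    have := mul_pos (one_div_pos.2 hS) h
    rwa [mul_add, ← mul_assoc _ _ (dualPressure u b), one_div_mul_cancel hS.ne', one_mul] at this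

/-! ### Edges and normals of a convex polygon -/

theorem IsConvexPolygon.edge_ne_zero {J : ℕ} {P : Polygon Plane J} (hP : IsConvexPolygon P)
    (j : Fin J) : edge P j ≠ 0 := by
  obtain ⟨hJ, hP⟩ := hP
  -- As `J ≥ 3`, some vertex is not an endpoint of the edge. Convexity puts it strictly to one side,
  -- which is impossible for a zero edge vector.
  obtain ⟨k, hk⟩ : ∃ k, k ∉ ({j, finRotate J j} : Finset (Fin J)) := by
    by_contra! h
    have h1 := Finset.card_le_card (fun k _ => h k : Finset.univ ⊆ _)
    have h2 := Finset.card_le_two (a := j) (b := finRotate J j)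
    rw [Finset.card_univ, Fintype.card_fin] at h1
    omega
  simp only [Finset.mem_insert, Finset.mem_singleton, not_or] at hk
  intro h0
  have := hP j k hk.1 hk.2
  simp [h0] at this

theorem sum_edge_eq_zero {J : ℕ} (P : Polygon Plane J) : ∑ j, edge P j = 0 := by
  simp only [edge, Finset.sum_sub_distrib]
  rw [Equiv.sum_comp (finRotate J) fun j => P j, sub_self]

theorem edgeLength_smul_outwardNormal {J : ℕ} {P : Polygon Plane J} (hP : IsConvexPolygon P)
    (j : Fin J) : edgeLength P j • outwardNormal P j = !₂[edge P j 1, -edge P j 0] :=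
  smul_inv_smul₀ (norm_ne_zero_iff.2 (hP.edge_ne_zero j)) _

theorem outwardNormal_sq_add_sq {J : ℕ} {P : Polygon Plane J} (hP : IsConvexPolygon P)
    (j : Fin J) : outwardNormal P j 0 ^ 2 + outwardNormal P j 1 ^ 2 = 1 := by
  have h0 : edgeLength P j ≠ 0 := norm_ne_zero_iff.2 (hP.edge_ne_zero j)
  have h1 : edgeLength P j ^ 2 = edge P j 0 ^ 2 + edge P j 1 ^ 2 := by
    rw [edgeLength, EuclideanSpace.norm_sq_eq, Fin.sum_univ_two]
    simp
  simp only [outwardNormal, PiLp.smul_apply, smul_eq_mul, Matrix.cons_val]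
  field_simp
  rw [h1]
  ring

end RMHD

/-! ### Boxes and convex polygons -/

theorem theorem2p5 (Γ : ℝ) (hΓ : 1 < Γ) (hΓ2 : Γ ≤ 2) (L : ℕ) (ω : Fin L → ℝ)
    (hω : ∀ i, 0 < ω i) (hω1 : ∑ i, ω i = 1) (α : ℝ) (hα : 1 ≤ α) :
    -- two space dimensions; `Ut, Uh, Ub, Uv` are the tilde, hat, bar and breve states
    (∀ (Δx Δy : ℝ), 0 < Δx → 0 < Δy →
      ∀ Ut Uh Ub Uv : Fin L → RMHD.ConsState,
      (∀ i, Ut i ∈ RMHD.admissibleSet Γ) → (∀ i, Uh i ∈ RMHD.admissibleSet Γ) →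
      (∀ i, Ub i ∈ RMHD.admissibleSet Γ) → (∀ i, Uv i ∈ RMHD.admissibleSet Γ) →
      (∑ i, ω i * (RMHD.magneticField (Ut i) 0 - RMHD.magneticField (Uh i) 0)) / Δx
        + (∑ i, ω i * (RMHD.magneticField (Ub i) 1 - RMHD.magneticField (Uv i) 1)) / Δy = 0 →
      (1 / (2 * (1 / Δx + 1 / Δy))) • ∑ i, ω i •
          ((1 / Δx) • (Ut i - α⁻¹ • RMHD.flux Γ 0 (Ut i) + Uh i + α⁻¹ • RMHD.flux Γ 0 (Uh i))
            + (1 / Δy) • (Ub i - α⁻¹ • RMHD.flux Γ 1 (Ub i) + Uv i + α⁻¹ • RMHD.flux Γ 1 (Uv i)))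
        ∈ RMHD.admissibleSet Γ) ∧
    -- three space dimensions
    (∀ (Δx Δy Δz : ℝ), 0 < Δx → 0 < Δy → 0 < Δz →
      ∀ Ut Uh Ub Uv Ubb Uvv : Fin L → RMHD.ConsState,
      (∀ i, Ut i ∈ RMHD.admissibleSet Γ) → (∀ i, Uh i ∈ RMHD.admissibleSet Γ) →
      (∀ i, Ub i ∈ RMHD.admissibleSet Γ) → (∀ i, Uv i ∈ RMHD.admissibleSet Γ) →
      (∀ i, Ubb i ∈ RMHD.admissibleSet Γ) → (∀ i, Uvv i ∈ RMHD.admissibleSet Γ) →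
      (∑ i, ω i * (RMHD.magneticField (Ut i) 0 - RMHD.magneticField (Uh i) 0)) / Δx
        + (∑ i, ω i * (RMHD.magneticField (Ub i) 1 - RMHD.magneticField (Uv i) 1)) / Δy
        + (∑ i, ω i * (RMHD.magneticField (Ubb i) 2 - RMHD.magneticField (Uvv i) 2)) / Δz = 0 →
      (1 / (2 * (1 / Δx + 1 / Δy + 1 / Δz))) • ∑ i, ω i •
          ((1 / Δx) • (Ut i - α⁻¹ • RMHD.flux Γ 0 (Ut i) + Uh i + α⁻¹ • RMHD.flux Γ 0 (Uh i))
            + (1 / Δy) • (Ub i - α⁻¹ • RMHD.flux Γ 1 (Ub i) + Uv i + α⁻¹ • RMHD.flux Γ 1 (Uv i))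
            + (1 / Δz) •
              (Ubb i - α⁻¹ • RMHD.flux Γ 2 (Ubb i) + Uvv i + α⁻¹ • RMHD.flux Γ 2 (Uvv i)))
        ∈ RMHD.admissibleSet Γ) ∧
    -- convex polygonal cells in two space dimensions
    (∀ (J : ℕ) (P : Polygon RMHD.Plane J), RMHD.IsConvexPolygon P →
      ∀ U : Fin L → Fin J → RMHD.ConsState,
      (∀ i j, U i j ∈ RMHD.admissibleSet Γ) →
      ∑ j, (∑ i, ω i * (RMHD.magneticField (U i j) 0 * RMHD.outwardNormal P j 0
          + RMHD.magneticField (U i j) 1 * RMHD.outwardNormal P j 1)) * RMHD.edgeLength P j = 0 →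
      (1 / ∑ j, RMHD.edgeLength P j) • ∑ j, RMHD.edgeLength P j • ∑ i, ω i •
          (U i j - α⁻¹ • (RMHD.outwardNormal P j 0 • RMHD.flux Γ 0 (U i j)
            + RMHD.outwardNormal P j 1 • RMHD.flux Γ 1 (U i j)))
        ∈ RMHD.admissibleSet Γ) := by
  refine ⟨fun Δx Δy hx hy Ut Uh Ub Uv ht hh hb hv hdiv => ?_,
    fun Δx Δy Δz hx hy hz Ut Uh Ub Uv Ubb Uvv ht hh hb hv hbb hvv hdiv => ?_,
    fun J P hP U hU hdiv => ?_⟩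
  -- A box has two opposite faces per axis, each weighted by area over volume; this doubling is the
  -- factor 2 in the normalization. The tilde and bar states take the outward normals `+e_k`, the
  -- hat and breve states `-e_k`.
  · have key := RMHD.laxFriedrichs_mem_admissibleSet hΓ hΓ2 hω hω1 hα
      (l := ![1 / Δx, 1 / Δx, 1 / Δy, 1 / Δy])
      (n := ![![1, 0, 0], ![-1, 0, 0], ![0, 1, 0], ![0, -1, 0]])
      (U := fun i => ![Ut i, Uh i, Ub i, Uv i])
      (by intro j; fin_cases j <;> simpa) (by intro j; fin_cases j <;> simp)
      (by ext k; fin_cases k <;> simp [Fin.sum_univ_four])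
      (by intro i j; fin_cases j <;> simp [ht, hh, hb, hv])
      (by
        refine Eq.trans ?_ hdiv
        simp [dotProduct, Fin.sum_univ_four, Fin.sum_univ_three, mul_sub, Finset.sum_sub_distrib]
        ring)
    convert key using 2
    · simp only [Fin.sum_univ_four, Matrix.cons_val]
      ring
    · simp only [Fin.sum_univ_four, Fin.sum_univ_three, Finset.smul_sum,
        ← Finset.sum_add_distrib, Matrix.cons_val]
      refine Finset.sum_congr rfl fun i _ => ?_
      module
  · have key := RMHD.laxFriedrichs_mem_admissibleSet hΓ hΓ2 hω hω1 hα
      (l := ![1 / Δx, 1 / Δx, 1 / Δy, 1 / Δy, 1 / Δz, 1 / Δz])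
      (n := ![![1, 0, 0], ![-1, 0, 0], ![0, 1, 0], ![0, -1, 0], ![0, 0, 1], ![0, 0, -1]])
      (U := fun i => ![Ut i, Uh i, Ub i, Uv i, Ubb i, Uvv i])
      (by intro j; fin_cases j <;> simpa) (by intro j; fin_cases j <;> simp)
      (by ext k; fin_cases k <;> simp [Fin.sum_univ_six])
      (by intro i j; fin_cases j <;> simp [ht, hh, hb, hv, hbb, hvv])
      (by
        refine Eq.trans ?_ hdiv
        simp [dotProduct, Fin.sum_univ_six, Fin.sum_univ_three, mul_sub, Finset.sum_sub_distrib]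
        ring)
    convert key using 2
    · simp only [Fin.sum_univ_six, Matrix.cons_val]
      ring
    · simp only [Fin.sum_univ_six, Fin.sum_univ_three, Finset.smul_sum,
        ← Finset.sum_add_distrib, Matrix.cons_val]
      refine Finset.sum_congr rfl fun i _ => ?_
      module
  · have hJ : Nonempty (Fin J) := ⟨⟨0, by have := hP.1; omega⟩⟩
    -- The scaled normals are the edge vectors turned by a right angle, and the edge vectors sum to
    -- zero around the polygon.
    have hclosed (k : Fin 2) :
        ∑ j, RMHD.edgeLength P j * RMHD.outwardNormal P j k = 0 := by
      have h (j : Fin J) : RMHD.edgeLength P j * RMHD.outwardNormal P j k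
          = ![RMHD.edge P j 1, -RMHD.edge P j 0] k :=
        congrArg (· k) (RMHD.edgeLength_smul_outwardNormal hP j)
      have h' (k : Fin 2) : ∑ j, RMHD.edge P j k = 0 := by
        simpa using congrArg (· k) (RMHD.sum_edge_eq_zero P)
      simp only [h]
      fin_cases k <;> simp [h']
    have key := RMHD.laxFriedrichs_mem_admissibleSet hΓ hΓ2 hω hω1 hα
      (l := RMHD.edgeLength P)
      (n := fun j => ![RMHD.outwardNormal P j 0, RMHD.outwardNormal P j 1, 0]) (U := U)
      (fun j => norm_pos_iff.2 (hP.edge_ne_zero j))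
      (fun j => by
        rw [← RMHD.outwardNormal_sq_add_sq hP j]
        simp [pow_two])
      (by ext k; fin_cases k <;> simp [hclosed])
      hU
      (by
        refine Eq.trans ?_ hdiv
        refine Finset.sum_congr rfl fun j _ => ?_
        rw [mul_comm]
        congr 1
        refine Finset.sum_congr rfl fun i _ => ?_
        simp only [dotProduct, Fin.sum_univ_three, Matrix.cons_val]
        ring)
    simpa only [Fin.sum_univ_three, Matrix.cons_val, zero_smul, add_zero] using key
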